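/- Let $\kappa$ be a regular cardinal and let $\mathcal{C}$ and $\mathcal{E}$ be $\kappa$-accessible categories. Let $\operatorname{Fun}_\kappa(\mathcal{C},\mathcal{E})$ be the category whose objects are the $\kappa$-accessible functors $\mathcal{C}\to\mathcal{E}$, that is, the functors preserving $\kappa$-filtered colimits, and whose morphisms are all natural transformations. Let $\operatorname{Comp}_\kappa(\mathcal{C})\subset\mathcal{C}$ be the full subcategory of $\kappa$-compact objects, that is, of the objects $c$ such that $\operatorname{Hom}(c,-):\mathcal{C}\to\operatorname{Sets}$ preserves $\kappa$-filtered colimits. Then the category $\operatorname{Fun}_\kappa(\mathcal{C},\mathcal{E})$ is accessible, i.e. it is $\mu$-accessible for some regular cardinal $\mu$. Moreover, restriction along the embedding $\operatorname{Comp}_\kappa(\mathcal{C})\subset\mathcal{C}$ is an equivalence of categories $$\operatorname{Fun}_\kappa(\mathcal{C},\mathcal{E})\;\xrightarrow{\ \sim\ }\;\operatorname{Fun}(\operatorname{Comp}_\kappa(\mathcal{C}),\mathcal{E}).$$ Here a category with small Hom-sets is called $\kappa$-accessible if it has all small $\kappa$-filtered colimits and there is an essentially small full subcategory consisting of $\kappa$-compact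 objects such that every object is a small $\kappa$-filtered colimit of objects of this subcategory. -/

import Mathlib

open CategoryTheory

universe w v₁ v₂ u₁ u₂

namespace CategoryTheory

/-- The property of a functor `F : C ⥤ E` of being `κ`-accessible, i.e. of preserving
`κ`-filtered colimits, as a property of objects of the functor category. -/
def isCardinalAccessibleFunctor (C : Type u₁) [Category.{v₁} C] (E : Type u₂) [Category.{v₂} E]
    (κ : Cardinal.{w}) [Fact κ.IsRegular] : ObjectProperty (C ⥤ E) :=
  fun F => F.IsCardinalAccessible κ

/-- The category `Fun_κ(C, E)`: the full subcategory of the category of functors `C ⥤ E`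
spanned by the `κ`-accessible functors (morphisms are all natural transformations). -/
abbrev CardinalAccessibleFunctor (C : Type u₁) [Category.{v₁} C]
    (E : Type u₂) [Category.{v₂} E] (κ : Cardinal.{w}) [Fact κ.IsRegular] :=
  (isCardinalAccessibleFunctor C E κ).FullSubcategory

/-- The category `Comp_κ(C)`: the full subcategory of `C` spanned by the `κ`-compact objects,
i.e. the objects `c` such that `Hom(c, -)` preserves `κ`-filtered colimits
(called `κ`-presentable in Mathlib). -/
abbrev CompactObjects (C : Type u₁) [Category.{v₁} C] (κ : Cardinal.{w}) [Fact κ.IsRegular] :=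
  (isCardinalPresentable C κ).FullSubcategory

/-- The restriction functor `Fun_κ(C, E) ⥤ Fun(Comp_κ(C), E)`, given by precomposition with
the inclusion `Comp_κ(C) ⥤ C`. -/
def restrictToCompactObjects (C : Type u₁) [Category.{v₁} C] (E : Type u₂) [Category.{v₂} E]
    (κ : Cardinal.{w}) [Fact κ.IsRegular] :
    CardinalAccessibleFunctor C E κ ⥤ (CompactObjects C κ ⥤ E) :=
  (isCardinalAccessibleFunctor C E κ).ι ⋙
    (Functor.whiskeringLeft (CompactObjects C κ) C E).obj (isCardinalPresentable C κ).ι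

end CategoryTheory

namespace CategoryTheory

open Limits

section KanExtension

universe v₃ u₃

variable {K : Type u₃} [Category.{v₃} K] {C : Type u₁} [Category.{v₁} C]
  {E : Type u₂} [Category.{v₂} E] (κ : Cardinal.{w}) [Fact κ.IsRegular]

/-- A pointwise left Kan extension along a functor `L` with `κ`-presentable values
is `κ`-accessible. -/
lemma Functor.LeftExtension.IsPointwiseLeftKanExtension.isCardinalAccessible
    {L : K ⥤ C} {G : K ⥤ E} {F : L.LeftExtension G} (hF : F.IsPointwiseLeftKanExtension)
    (hL : ∀ k, IsCardinalPresentable (L.obj k) κ) :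
    F.right.IsCardinalAccessible κ where
  preservesColimitOfShape J _ _ := ⟨fun {X} ↦ ⟨fun {c} hc ↦ by
    have := isFiltered_of_isCardinalFiltered J κ
    have aux (s : Cocone (X ⋙ F.right)) {k : K} (x : L.obj k ⟶ c.pt) :
        ∃ y : G.obj k ⟶ s.pt, ∀ (j : J) (x' : L.obj k ⟶ X.obj j), x' ≫ c.ι.app j = x →
          F.hom.app k ≫ F.right.map x' ≫ s.ι.app j = y := by
      obtain ⟨j, x', rfl⟩ := IsCardinalPresentable.exists_hom_of_isColimit κ hc x
      refine ⟨F.hom.app k ≫ F.right.map x' ≫ s.ι.app j, fun j₁ x₁ h₁ ↦ ?_⟩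
      obtain ⟨l, u, v, h⟩ := IsCardinalPresentable.exists_eq_of_isColimit κ hc _ _ h₁
      rw [← s.w u, ← s.w v]
      dsimp
      rw [← F.right.map_comp_assoc, ← F.right.map_comp_assoc, h]
    choose y hy using fun (s : Cocone (X ⋙ F.right)) (k : K) (x : L.obj k ⟶ c.pt) ↦ aux s x
    have hy' (s : Cocone (X ⋙ F.right)) {k k' : K} (u : k ⟶ k') (x : L.obj k' ⟶ c.pt) :
        G.map u ≫ y s k' x = y s k (L.map u ≫ x) := by
      obtain ⟨j, x', rfl⟩ := IsCardinalPresentable.exists_hom_of_isColimit κ hc x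
      rw [← hy s _ _ j x' rfl, ← hy s _ _ j (L.map u ≫ x') (by simp)]
      have := F.hom.naturality u
      dsimp at this
      rw [reassoc_of% this]
      simp
    have hd (s : Cocone (X ⋙ F.right)) : ∃ d : F.right.obj c.pt ⟶ s.pt,
        ∀ (k : K) (x : L.obj k ⟶ c.pt), F.hom.app k ≫ F.right.map x ≫ d = y s k x := by
      let t : Cocone (CostructuredArrow.proj L c.pt ⋙ G) :=
        { pt := s.pt
          ι := { app g := y s g.left g.hom
                 naturality g₁ g₂ φ := by
                  have := hy' s φ.left g₂.hom
                  rw [CostructuredArrow.w φ] at this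
                  exact this.trans (Category.comp_id _).symm } }
      exact ⟨(hF c.pt).desc t, fun k x ↦ (Category.assoc _ _ _).symm.trans
        ((hF c.pt).fac t (CostructuredArrow.mk x))⟩
    choose d hd using hd
    refine ⟨{ desc := d, fac s j := ?_, uniq s m hm := ?_ }⟩
    · refine (hF _).hom_ext' (fun k φ ↦ ?_)
      have := hd s k (φ ≫ c.ι.app j)
      rw [← hy s _ _ j φ rfl, Functor.map_comp, Category.assoc] at this
      exact this
    · refine (hF _).hom_ext' (fun k φ ↦ ?_)
      obtain ⟨j, x', rfl⟩ := IsCardinalPresentable.exists_hom_of_isColimit κ hc φ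
      rw [hd, ← hy s _ _ j x' rfl, ← hm, Functor.map_comp, Category.assoc]
      rfl⟩⟩

/-- A `κ`-accessible functor is the left Kan extension of its restriction along any dense
functor whose comma categories are `κ`-filtered and essentially small. -/
lemma Functor.IsCardinalAccessible.isLeftKanExtension (L : K ⥤ C) [L.IsDense]
    [∀ X, IsCardinalFiltered (CostructuredArrow L X) κ]
    [∀ X, EssentiallySmall.{w} (CostructuredArrow L X)]
    (F : C ⥤ E) [F.IsCardinalAccessible κ] :
    F.IsLeftKanExtension (𝟙 (L ⋙ F)) := by
  refine LeftExtension.IsPointwiseLeftKanExtension.isLeftKanExtension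
    (E := LeftExtension.mk F (𝟙 (L ⋙ F))) (fun X ↦ ?_)
  have := F.preservesColimitsOfShape_of_isCardinalAccessible_of_essentiallySmall κ
    (CostructuredArrow L X)
  exact IsColimit.ofIsoColimit (isColimitOfPreserves F (L.denseAt X))
    (Cocone.ext (Iso.refl _) (fun j ↦ by
      change F.map (𝟙 _ ≫ j.hom) ≫ 𝟙 _ = 𝟙 _ ≫ F.map j.hom
      simp))

end KanExtension

section

variable {C : Type u₁} [Category.{v₁} C] {E : Type u₂} [Category.{v₂} E]
  {κ : Cardinal.{w}} [Fact κ.IsRegular]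

lemma HasCardinalFilteredColimits.hasColimitsOfShape_of_essentiallySmall
    [HasCardinalFilteredColimits E κ] {J : Type u₁} [Category.{v₁} J]
    [EssentiallySmall.{w} J] [IsCardinalFiltered J κ] : HasColimitsOfShape J E := by
  have := IsCardinalFiltered.of_equivalence κ (equivSmallModel.{w} J)
  have := HasCardinalFilteredColimits.hasColimitsOfShape E κ (SmallModel.{w} J)
  exact hasColimitsOfShape_of_equivalence (equivSmallModel.{w} J).symm

instance [IsCardinalAccessibleCategory C κ] [HasCardinalFilteredColimits E κ]
    (G : CompactObjects C κ ⥤ E) :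
    (isCardinalPresentable C κ).ι.HasPointwiseLeftKanExtension G := fun X ↦ by
  have := HasCardinalFilteredColimits.hasColimitsOfShape_of_essentiallySmall (E := E) (κ := κ)
    (J := CostructuredArrow (isCardinalPresentable C κ).ι X)
  infer_instance

variable (C E κ) in
lemma isEquivalence_restrictToCompactObjects [IsCardinalAccessibleCategory C κ]
    [HasCardinalFilteredColimits E κ] :
    (restrictToCompactObjects C E κ).IsEquivalence := by
  let L := (isCardinalPresentable C κ).ι
  have bij (F F' : CardinalAccessibleFunctor C E κ) :
      Function.Bijective ((restrictToCompactObjects C E κ).map : (F ⟶ F') → _) := by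
    have : F.obj.IsCardinalAccessible κ := F.property
    have := Functor.IsCardinalAccessible.isLeftKanExtension κ L F.obj
    have h := (F.obj.homEquivOfIsLeftKanExtension (𝟙 (L ⋙ F.obj)) F'.obj).bijective.comp
      ((isCardinalAccessibleFunctor C E κ).fullyFaithfulι.homEquiv (X := F) (Y := F')).bijective
    exact (funext fun f ↦ (Category.id_comp _).symm :
      ((restrictToCompactObjects C E κ).map : (F ⟶ F') → _) = _) ▸ h
  have : (restrictToCompactObjects C E κ).Faithful := ⟨fun h ↦ (bij _ _).1 h⟩
  have : (restrictToCompactObjects C E κ).Full := ⟨fun f ↦ (bij _ _).2 f⟩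
  have : (restrictToCompactObjects C E κ).EssSurj := ⟨fun G ↦ by
    have acc := (L.isPointwiseLeftKanExtensionLeftKanExtensionUnit G).isCardinalAccessible κ
      (fun k ↦ k.property)
    exact ⟨⟨L.lan.obj G, acc⟩, ⟨(asIso (L.lanUnit.app G)).symm⟩⟩⟩
  exact {}

end

section FunctorCategory

variable {A : Type u₁} [Category.{v₁} A] {E : Type u₂} [Category.{v₂} E]
  (κ : Cardinal.{w}) [Fact κ.IsRegular]

instance [HasCardinalFilteredColimits E κ] : HasCardinalFilteredColimits (A ⥤ E) κ where
  hasColimitsOfShape J _ _ := by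
    have := HasCardinalFilteredColimits.hasColimitsOfShape E κ J
    infer_instance

/-- A functor with `κ`-presentable values whose source has less than `κ` arrows is
a `κ`-presentable object in the category of functors. -/
lemma isCardinalPresentable_functor [HasCardinalFilteredColimits E κ]
    (hA : HasCardinalLT (Arrow A) κ) (G : A ⥤ E)
    (hG : ∀ a, IsCardinalPresentable (G.obj a) κ) :
    IsCardinalPresentable G κ where
  preservesColimitOfShape J _ _ := ⟨fun {X} ↦ ⟨fun {c} hc ↦ ⟨by
    have := isFiltered_of_isCardinalFiltered J κ
    have := HasCardinalFilteredColimits.hasColimitsOfShape E κ J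
    have hc' (a : A) := isColimitOfPreserves ((evaluation A E).obj a) hc
    have hA' := hasCardinalLT_of_hasCardinalLT_arrow hA
    refine Types.FilteredColimit.isColimitOf' _ _ (fun f ↦ ?_) (fun j f g h ↦ ?_)
    · change G ⟶ c.pt at f
      obtain ⟨m, g, hg⟩ : ∃ (m : J) (g : ∀ a, G.obj a ⟶ (X.obj m).obj a),
          ∀ a, g a ≫ (c.ι.app m).app a = f.app a := by
        have (a : A) : ∃ (j : J) (g : G.obj a ⟶ (X.obj j).obj a),
            g ≫ (c.ι.app j).app a = f.app a :=
          IsCardinalPresentable.exists_hom_of_isColimit κ (hc' a) (f.app a)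
        choose j g hg using this
        refine ⟨IsCardinalFiltered.max j hA',
          fun a ↦ g a ≫ (X.map (IsCardinalFiltered.toMax j hA' a)).app a, fun a ↦ ?_⟩
        rw [← hg, ← c.w (IsCardinalFiltered.toMax j hA' a)]
        simp
      have (φ : Arrow A) : ∃ (k : J) (u : m ⟶ k),
          (G.map φ.hom ≫ g φ.right) ≫ (X.map u).app φ.right =
            (g φ.left ≫ (X.obj m).map φ.hom) ≫ (X.map u).app φ.right :=
        IsCardinalPresentable.exists_eq_of_isColimit' κ (hc' φ.right) _ _ (by
          change _ ≫ (c.ι.app m).app _ = _ ≫ (c.ι.app m).app _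
          rw [Category.assoc, Category.assoc, hg, (c.ι.app m).naturality, reassoc_of% hg,
            f.naturality]
          rfl)
      choose k u hu using this
      obtain ⟨l, v, b, hl⟩ := IsCardinalFiltered.wideSpan u hA
      refine ⟨l, { app a := g a ≫ (X.map b).app a, naturality a a' φ := ?_ }, ?_⟩
      · have := hu (Arrow.mk φ)
        dsimp at this
        rw [← hl (Arrow.mk φ)]
        simp only [Functor.map_comp, NatTrans.comp_app, Category.assoc] at this ⊢
        rw [reassoc_of% this, ← NatTrans.naturality, NatTrans.naturality_assoc]
      · refine NatTrans.ext (funext fun a ↦ ?_)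
        have := congr_arg (fun f ↦ NatTrans.app f a) (c.w b)
        dsimp at this
        change f.app a = (g a ≫ (X.map b).app a) ≫ (c.ι.app l).app a
        rw [Category.assoc, this, hg]
    · change G ⟶ X.obj j at f
      change G ⟶ X.obj j at g
      change f ≫ c.ι.app j = g ≫ c.ι.app j at h
      have (a : A) : ∃ (k : J) (u : j ⟶ k),
          f.app a ≫ (X.map u).app a = g.app a ≫ (X.map u).app a :=
        IsCardinalPresentable.exists_eq_of_isColimit' κ (hc' a) _ _
          (congr_arg (fun f ↦ NatTrans.app f a) h)
      choose k u hu using this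
      obtain ⟨l, v, b, hl⟩ := IsCardinalFiltered.wideSpan u hA'
      refine ⟨l, b, ?_⟩
      change f ≫ X.map b = g ≫ X.map b
      ext a
      rw [← hl a]
      simp [reassoc_of% (hu a)]⟩⟩⟩

lemma essentiallySmall_functor (A : Type w) [SmallCategory A] [LocallySmall.{w} E]
    (Q : ObjectProperty E) [ObjectProperty.EssentiallySmall.{w} Q] :
    ObjectProperty.EssentiallySmall.{w}
      (fun G : A ⥤ E ↦ ∀ a, Q (G.obj a) : ObjectProperty (A ⥤ E)) := by
  let e := equivSmallModel.{w} Q.FullSubcategory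
  refine ⟨.ofObj (fun H : A ⥤ SmallModel.{w} Q.FullSubcategory ↦ H ⋙ e.inverse ⋙ Q.ι),
    inferInstance, fun G hG ↦ ?_⟩
  refine ⟨_, ⟨Q.lift G hG ⋙ e.functor⟩, ⟨?_⟩⟩
  exact Functor.isoWhiskerRight (Functor.isoWhiskerLeft (Q.lift G hG) e.unitIso) Q.ι

end FunctorCategory

section DensePoints

variable {P : Type u₁} [Category.{v₁} P] {E : Type u₂} [Category.{v₂} E] (L : P ⥤ E) [L.IsDense]

lemma Functor.IsDense.mono_of_injective {M Y : E} (m : M ⟶ Y)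
    (hm : ∀ (p : P) (x y : L.obj p ⟶ M), x ≫ m = y ≫ m → x = y) : Mono m where
  right_cancellation f g h := (L.denseAt _).hom_ext' (fun p φ ↦ by
    change 𝟙 _ ≫ φ ≫ f = 𝟙 _ ≫ φ ≫ g
    simpa using hm p (φ ≫ f) (φ ≫ g) (by simp [h]))

/-- A morphism factors through a monomorphism as soon as it does so on the generalized
elements given by a dense functor. -/
lemma Functor.IsDense.exists_factorization {M Y Z : E} (m : M ⟶ Y) [Mono m] (g : Z ⟶ Y)
    (hg : ∀ (p : P) (z : L.obj p ⟶ Z), ∃ x : L.obj p ⟶ M, x ≫ m = z ≫ g) :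
    ∃ h : Z ⟶ M, h ≫ m = g := by
  choose x hx using hg
  let t : Cocone (CostructuredArrow.proj L Z ⋙ L) :=
    { pt := M
      ι := { app z := x _ z.hom
             naturality z₁ z₂ φ := by
              change L.map φ.left ≫ x _ z₂.hom = x _ z₁.hom ≫ 𝟙 M
              rw [Category.comp_id, ← cancel_mono m, Category.assoc, hx, hx,
                CostructuredArrow.w_assoc φ] } }
  obtain ⟨d, hd⟩ : ∃ d : Z ⟶ M, ∀ (p : P) (φ : L.obj p ⟶ Z), φ ≫ d = x p φ := by
    refine ⟨(L.denseAt Z).desc t, fun p φ ↦ ?_⟩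
    have := (L.denseAt Z).fac t (CostructuredArrow.mk φ)
    change (𝟙 _ ≫ φ) ≫ _ = x _ φ at this
    rwa [Category.id_comp] at this
  refine ⟨d, (L.denseAt _).hom_ext' (fun p φ ↦ ?_)⟩
  change 𝟙 _ ≫ φ ≫ d ≫ m = 𝟙 _ ≫ φ ≫ g
  rw [reassoc_of% hd, hx]

lemma Functor.IsDense.isIso_of_bijective {M Y : E} (m : M ⟶ Y)
    (hm : ∀ (p : P) (x y : L.obj p ⟶ M), x ≫ m = y ≫ m → x = y)
    (hm' : ∀ (p : P) (y : L.obj p ⟶ Y), ∃ x : L.obj p ⟶ M, x ≫ m = y) : IsIso m := by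
  have := mono_of_injective L m hm
  obtain ⟨s, hs⟩ := exists_factorization L m (𝟙 Y) (by simpa using hm')
  exact ⟨s, by simp [← cancel_mono m, hs], hs⟩

end DensePoints

section Subobjects

variable {P : Type w} [SmallCategory P] {E : Type u₁} [Category.{w} E]
  {L : P ⥤ E} (κ : Cardinal.{w}) [Fact κ.IsRegular]

/-- A family of generalized elements of an object which is stable under precomposition
and is `κ`-filtered as a full subcategory of the comma category. -/
structure IsCardinalFilteredSieve {Y : E} (S : ObjectProperty (CostructuredArrow L Y)) :
    Prop where
  downward : ∀ ⦃y z : CostructuredArrow L Y⦄ (_ : y ⟶ z), S z → S y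
  isCardinalFiltered : IsCardinalFiltered S.FullSubcategory κ

lemma hasCardinalLT_arrow_fullSubcategory {lam : Cardinal.{w}} [Fact lam.IsRegular]
    (hP : HasCardinalLT (Arrow P) lam) {Y : E} {S : ObjectProperty (CostructuredArrow L Y)}
    (hS : HasCardinalLT (Subtype S) lam) : HasCardinalLT (Arrow S.FullSubcategory) lam := by
  have hlam : Cardinal.aleph0 ≤ lam := Cardinal.IsRegular.aleph0_le Fact.out
  refine (hasCardinalLT_prod hlam (hasCardinalLT_prod hlam hS hS) hP).of_injective
    (fun f ↦ ((⟨f.left.obj, f.left.property⟩, ⟨f.right.obj, f.right.property⟩),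
      Arrow.mk f.hom.hom.left)) ?_
  rintro ⟨⟨y, hy⟩, ⟨z, hz⟩, f⟩ ⟨⟨y', hy'⟩, ⟨z', hz'⟩, f'⟩ h
  simp only [Prod.mk.injEq, Subtype.mk.injEq] at h
  obtain ⟨⟨rfl, rfl⟩, h⟩ := h
  obtain rfl : f = f' := by
    apply ObjectProperty.hom_ext
    apply CostructuredArrow.hom_ext
    exact (Arrow.mk_inj _ _).1 h
  rfl

variable [L.Full] [L.IsDense] [HasCardinalFilteredColimits E κ]
  (hL : ∀ p, IsCardinalPresentable (L.obj p) κ)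

include hL in
/-- A `κ`-filtered sieve of generalized elements is the family of generalized elements
of a subobject. -/
lemma IsCardinalFilteredSieve.exists_subobject {Y : E}
    {S : ObjectProperty (CostructuredArrow L Y)} (hS : IsCardinalFilteredSieve κ S)
    {lam : Cardinal.{w}} [Fact lam.IsRegular]
    (hP : HasCardinalLT (Arrow P) lam) (hS' : HasCardinalLT (Subtype S) lam) :
    ∃ (M : E) (m : M ⟶ Y), Mono m ∧
      (∀ (p : P) (x : L.obj p ⟶ Y),
        S (CostructuredArrow.mk x) ↔ ∃ x' : L.obj p ⟶ M, x' ≫ m = x) ∧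
      (isCardinalPresentable E κ).colimitsCardinalClosure lam M := by
  have := hS.isCardinalFiltered
  have := HasCardinalFilteredColimits.hasColimitsOfShape E κ S.FullSubcategory
  let D : S.FullSubcategory ⥤ E := S.ι ⋙ CostructuredArrow.proj L Y ⋙ L
  let s : Cocone D :=
    { pt := Y
      ι := { app z := z.obj.hom
             naturality z z' f := by
              exact (CostructuredArrow.w f.hom).trans (Category.comp_id _).symm } }
  let m : colimit D ⟶ Y := colimit.desc D s
  have hm (z : S.FullSubcategory) : colimit.ι D z ≫ m = z.obj.hom := colimit.ι_desc _ _
  have key {p : P} (x : L.obj p ⟶ colimit D) :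
      ∃ h : S (CostructuredArrow.mk (x ≫ m)), x = colimit.ι D ⟨_, h⟩ := by
    obtain ⟨z, x', rfl⟩ := IsCardinalPresentable.exists_hom_of_isColimit κ (colimit.isColimit D) x
    obtain ⟨u, rfl⟩ := L.map_surjective x'
    let f : CostructuredArrow.mk ((L.map u ≫ (colimit.cocone D).ι.app z) ≫ m) ⟶ z.obj :=
      CostructuredArrow.homMk u (by
        rw [CostructuredArrow.mk_hom_eq_self, Category.assoc]
        exact congr_arg _ (hm z).symm)
    have h := hS.downward f z.property
    exact ⟨h, (colimit.w D (ObjectProperty.homMk f : ⟨_, h⟩ ⟶ z))⟩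
  refine ⟨colimit D, m, Functor.IsDense.mono_of_injective L m (fun p x y h ↦ ?_),
    fun p x ↦ ⟨fun hx ↦ ⟨colimit.ι D ⟨_, hx⟩, hm ⟨_, hx⟩⟩, ?_⟩, ?_⟩
  · obtain ⟨hx, hx'⟩ := key x
    obtain ⟨hy, hy'⟩ := key y
    have aux (x y : L.obj p ⟶ Y) (hx : S (CostructuredArrow.mk x))
        (hy : S (CostructuredArrow.mk y)) (h : x = y) :
        (colimit.ι D ⟨_, hx⟩ : L.obj p ⟶ _) = colimit.ι D ⟨_, hy⟩ := by
      subst h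
      rfl
    exact hx'.trans ((aux _ _ hx hy h).trans hy'.symm)
  · rintro ⟨x', rfl⟩
    exact (key x').1
  · have := (isCardinalPresentable E κ).isClosedUnderColimitsOfShape_colimitsCardinalClosure lam
      _ (hasCardinalLT_arrow_fullSubcategory hP hS')
    exact ObjectProperty.prop_colimit _ _
      (fun z ↦ ObjectProperty.le_colimitsCardinalClosure _ _ _ (hL _))

variable {A : Type u₂} [Category.{v₂} A]

include hL in
lemma exists_subfunctor (X : A ⥤ E)
    (S : ∀ a, ObjectProperty (CostructuredArrow L (X.obj a)))
    (hS : ∀ a, IsCardinalFilteredSieve κ (S a))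
    (hX : ∀ ⦃a b : A⦄ (f : a ⟶ b) (y : CostructuredArrow L (X.obj a)),
      S a y → S b ((CostructuredArrow.map (X.map f)).obj y))
    {lam : Cardinal.{w}} [Fact lam.IsRegular]
    (hP : HasCardinalLT (Arrow P) lam) (hS' : ∀ a, HasCardinalLT (Subtype (S a)) lam) :
    ∃ (M : A ⥤ E) (m : M ⟶ X), (∀ a, Mono (m.app a)) ∧
      (∀ (a : A) (p : P) (x : L.obj p ⟶ X.obj a),
        S a (CostructuredArrow.mk x) ↔ ∃ x' : L.obj p ⟶ M.obj a, x' ≫ m.app a = x) ∧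
      ∀ a, (isCardinalPresentable E κ).colimitsCardinalClosure lam (M.obj a) := by
  choose M m hm hSm hM using fun a ↦ (hS a).exists_subobject κ hL hP (hS' a)
  have (a b : A) (f : a ⟶ b) : ∃ g : M a ⟶ M b, g ≫ m b = m a ≫ X.map f :=
    Functor.IsDense.exists_factorization L _ _ (fun p z ↦ by
      rw [← Category.assoc, ← hSm]
      exact hX f _ ((hSm _ _ _).2 ⟨z, rfl⟩))
  choose g hg using this
  exact ⟨{ obj := M, map := g _ _, map_id a := by simp [← cancel_mono (m a), hg],
           map_comp f f' := by simp [← cancel_mono (m _), hg, reassoc_of% hg] },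
    { app := m, naturality _ _ f := hg _ _ f }, hm, hSm, hM⟩

omit [L.Full] in
include hL in
/-- A `κ`-filtered diagram of subobjects is a colimit diagram when the subobjects
jointly cover the generalized elements. -/
lemma nonempty_isColimit_of_mono {J : Type w} [SmallCategory J] [IsCardinalFiltered J κ]
    {D : J ⥤ E} (c : Cocone D) [∀ j, Mono (c.ι.app j)]
    (hc : ∀ (p : P) (x : L.obj p ⟶ c.pt), ∃ (j : J) (x' : L.obj p ⟶ D.obj j),
      x' ≫ c.ι.app j = x) : Nonempty (IsColimit c) := by
  have := isFiltered_of_isCardinalFiltered J κ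
  have := HasCardinalFilteredColimits.hasColimitsOfShape E κ J
  have : IsIso (colimit.desc D c) := by
    refine Functor.IsDense.isIso_of_bijective L _ (fun p x y h ↦ ?_) (fun p y ↦ ?_)
    · obtain ⟨j, x, rfl⟩ := IsCardinalPresentable.exists_hom_of_isColimit κ
        (colimit.isColimit D) x
      obtain ⟨k, y, rfl⟩ := IsCardinalPresentable.exists_hom_of_isColimit κ
        (colimit.isColimit D) y
      have : x ≫ D.map (IsFiltered.leftToMax j k) = y ≫ D.map (IsFiltered.rightToMax j k) := by
        rw [← cancel_mono (c.ι.app _)]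
        simpa using h
      simp only [colimit.cocone_ι, ← colimit.w D (IsFiltered.leftToMax j k),
        ← colimit.w D (IsFiltered.rightToMax j k), reassoc_of% this]
    · obtain ⟨j, x, rfl⟩ := hc p y
      exact ⟨x ≫ colimit.ι D j, by simp⟩
  exact ⟨IsColimit.ofIsoColimit (colimit.isColimit D)
    (Cocone.ext (asIso (colimit.desc D c)))⟩

end Subobjects

end CategoryTheory

namespace Cardinal

lemma hasCardinalLT_succ_iff {T : Type w} {μ : Cardinal.{w}} :
    HasCardinalLT T (Order.succ μ) ↔ #T ≤ μ := by
  rw [hasCardinalLT_iff_cardinal_mk_lt, Order.lt_succ_iff]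

/-- Any subset of cardinality `≤ 2 ^ θ` is contained in a subset of cardinality `≤ 2 ^ θ` which
is stable under `2 ^ θ` operations whose arities are less than `κ`, when `κ ≤ θ`. -/
lemma exists_closed_superset {T I : Type w} {κ θ : Cardinal.{w}} (hθ : ℵ₀ ≤ θ) (hκθ : κ ≤ θ)
    (hI : #I ≤ 2 ^ θ) (N : T → Set T) (hN : ∀ t, #(N t) ≤ 2 ^ θ)
    (m : I → ∀ s : Set T, HasCardinalLT s κ → T) (B : Set T) (hB : #B ≤ 2 ^ θ) :
    ∃ S : Set T, B ⊆ S ∧ #S ≤ 2 ^ θ ∧ (∀ t ∈ S, N t ⊆ S) ∧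
      ∀ (i : I) (s : Set T) (hs : HasCardinalLT s κ), s ⊆ S → m i s hs ∈ S := by
  obtain ⟨M, hM⟩ : ∃ M : Type w, #M = 2 ^ θ := ⟨_, mk_out _⟩
  have hμ : ℵ₀ ≤ (2 : Cardinal) ^ θ := hθ.trans (cantor θ).le
  have (t : T) : ∃ n : M → T, N t ⊆ Set.range n := by
    obtain ⟨e⟩ : #(N t) ≤ #M := by simpa [hM] using hN t
    exact ⟨Function.extend e Subtype.val (fun _ ↦ t),
      fun x hx ↦ ⟨e ⟨x, hx⟩, e.injective.extend_apply _ _ _⟩⟩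
  choose n hn using this
  let R := { s : Set κ.ord.ToType // HasCardinalLT s κ }
  let β : B ⊕ M ⊕ (I × R) → Type w :=
    Sum.elim (fun _ ↦ PEmpty) (Sum.elim (fun _ ↦ PUnit) (fun x ↦ x.2.1))
  let op : (Σ a, β a → T) → T := fun x ↦ match x with
    | ⟨.inl b, _⟩ => b
    | ⟨.inr (.inl x), f⟩ => n (f ⟨⟩) x
    | ⟨.inr (.inr (i, r)), f⟩ => m i (Set.range f) (r.2.of_surjective _
        Set.rangeFactorization_surjective)
  let ev : WType β → T := WType.elim T op
  refine ⟨Set.range ev, fun b hb ↦ ⟨.mk (.inl ⟨b, hb⟩) PEmpty.elim, rfl⟩,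
    mk_range_le.trans (WType.cardinalMk_le_of_le ?_), ?_, ?_⟩
  · have hα : #(B ⊕ M ⊕ (I × R)) ≤ 2 ^ θ := by
      have hR : #R ≤ 2 ^ θ := by
        refine (mk_subtype_le _).trans ?_
        rw [mk_set]
        exact power_le_power_left two_ne_zero (by simpa using hκθ)
      simp only [mk_sum, mk_prod, lift_id]
      exact add_le_of_le hμ hB (add_le_of_le hμ hM.le ((mul_le_mul' hI hR).trans
        (mul_eq_self hμ).le))
    have hβ (a) : ((2 : Cardinal) ^ θ) ^ #(β a) ≤ 2 ^ θ := by
      have : #(β a) ≤ θ := by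
        obtain b | x | ⟨i, r⟩ := a
        · simp [β]
        · simpa [β] using one_le_aleph0.trans hθ
        · exact ((hasCardinalLT_iff_cardinal_mk_lt _ _).1 r.2).le.trans hκθ
      rw [← power_mul]
      exact power_le_power_left two_ne_zero ((mul_le_mul' le_rfl this).trans (mul_eq_self hθ).le)
    refine (sum_le_sum _ _ hβ).trans ?_
    rw [sum_const']
    exact (mul_le_mul' hα le_rfl).trans (mul_eq_self hμ).le
  · rintro _ ⟨x, rfl⟩ y hy
    obtain ⟨z, rfl⟩ := hn _ hy
    exact ⟨.mk (.inr (.inl z)) (fun _ ↦ x), rfl⟩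
  · intro i s hs hs'
    obtain ⟨e⟩ : #s ≤ #κ.ord.ToType := by
      simpa using ((hasCardinalLT_iff_cardinal_mk_lt _ _).1 hs).le
    choose x hx using fun t : s ↦ hs' t.2
    let r : R := ⟨Set.range e, hs.of_surjective _ Set.rangeFactorization_surjective⟩
    let e' : s ≃ Set.range e := Equiv.ofInjective e e.injective
    refine ⟨.mk (.inr (.inr (i, r))) (fun k ↦ x (e'.symm k)), ?_⟩
    have : Set.range (fun k ↦ ev (x (e'.symm k))) = s := by
      ext t
      constructor
      · rintro ⟨k, rfl⟩
        simp only [hx]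
        exact (e'.symm k).2
      · intro ht
        exact ⟨e' ⟨t, ht⟩, by simp [hx]⟩
    have aux (s' : Set T) (h : s' = s) (hs' : HasCardinalLT s' κ) : m i s' hs' = m i s hs := by
      subst h
      rfl
    exact aux _ this _

end Cardinal

namespace CategoryTheory

open Limits Cardinal

section

variable {P : Type w} [SmallCategory P] {E : Type u₁} [Category.{w} E]
  {L : P ⥤ E} (κ : Cardinal.{w}) [Fact κ.IsRegular]
  [∀ Y, IsCardinalFiltered (CostructuredArrow L Y) κ]
  {A : Type w} [SmallCategory A]

omit [∀ Y, IsCardinalFiltered (CostructuredArrow L Y) κ] [Fact κ.IsRegular] in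
lemma CostructuredArrow.exists_eq_mk_of_hom {Y : E} {y z : CostructuredArrow L Y} (u : y ⟶ z) :
    ∃ v : Σ p, (p ⟶ z.left), y = CostructuredArrow.mk (L.map v.2 ≫ z.hom) :=
  ⟨⟨y.left, u.left⟩, by rw [CostructuredArrow.w u]; exact CostructuredArrow.eq_mk y⟩

/-- The downward Löwenheim-Skolem property for families of generalized elements of the values
of a functor. -/
lemma exists_isCardinalFilteredSieve (X : A ⥤ E) {θ : Cardinal.{w}} (hκθ : κ ≤ θ)
    (hP : #(Arrow P) ≤ θ) (hA : #(Arrow A) ≤ θ)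
    (B : Set (Σ a, CostructuredArrow L (X.obj a)))
    (hB : HasCardinalLT B (Order.succ (2 ^ θ))) :
    ∃ S : Set (Σ a, CostructuredArrow L (X.obj a)), B ⊆ S ∧
      HasCardinalLT S (Order.succ (2 ^ θ)) ∧
      (∀ a, IsCardinalFilteredSieve κ
        (fun y ↦ ⟨a, y⟩ ∈ S : ObjectProperty (CostructuredArrow L (X.obj a)))) ∧
      ∀ ⦃a b : A⦄ (f : a ⟶ b) (y : CostructuredArrow L (X.obj a)), ⟨a, y⟩ ∈ S →
        ⟨b, (CostructuredArrow.map (X.map f)).obj y⟩ ∈ S := by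
  have hκ : ℵ₀ ≤ κ := IsRegular.aleph0_le Fact.out
  have hθ : ℵ₀ ≤ θ := hκ.trans hκθ
  have hμ : ℵ₀ ≤ (2 : Cardinal) ^ θ := hθ.trans (cantor θ).le
  have : Fact (Order.succ ((2 : Cardinal) ^ θ)).IsRegular := ⟨isRegular_succ hμ⟩
  let T := Σ a, CostructuredArrow L (X.obj a)
  let V (z : T) := Σ p, (p ⟶ z.2.left)
  let y (z : T) (v : V z) : CostructuredArrow L (X.obj z.1) :=
    CostructuredArrow.mk (L.map v.2 ≫ z.2.hom)
  let W (z : T) := Σ v : V z, { U : Set (y z v ⟶ z.2) // HasCardinalLT U κ }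
  let N (z : T) : Set T := Set.range (fun v : V z ↦ ⟨z.1, y z v⟩) ∪
    Set.range (fun f : Σ b, (z.1 ⟶ b) ↦ ⟨f.1, (CostructuredArrow.map (X.map f.2)).obj z.2⟩) ∪
    Set.range (fun x : W z ↦ ⟨z.1, IsCardinalFiltered.coeq (fun u : x.2.1 ↦ u.1) x.2.2⟩)
  have hV (z : T) : #(V z) ≤ θ := by
    refine le_trans (mk_le_of_injective (f := fun v ↦ Arrow.mk v.2) ?_) hP
    rintro ⟨p, v⟩ ⟨p', v'⟩ h
    obtain rfl : p = p' := congr_arg Comma.left h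
    obtain rfl : v = v' := (Arrow.mk_inj _ _).1 h
    rfl
  have hN (z : T) : #(N z) ≤ 2 ^ θ := by
    rw [← hasCardinalLT_succ_iff]
    refine hasCardinalLT_union (hμ.trans (Order.le_succ _))
      (hasCardinalLT_union (hμ.trans (Order.le_succ _)) ?_ ?_) ?_
    · rw [hasCardinalLT_succ_iff]
      exact mk_range_le.trans ((hV z).trans (cantor θ).le)
    · rw [hasCardinalLT_succ_iff]
      refine mk_range_le.trans (le_trans (le_trans ?_ hA) (cantor θ).le)
      refine mk_le_of_injective (f := fun v ↦ Arrow.mk v.2) ?_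
      rintro ⟨b, v⟩ ⟨b', v'⟩ h
      obtain rfl : b = b' := congr_arg Comma.right h
      obtain rfl : v = v' := (Arrow.mk_inj _ _).1 h
      rfl
    · suffices HasCardinalLT (W z) (Order.succ (2 ^ θ)) from
        this.of_surjective _ Set.rangeFactorization_surjective
      refine hasCardinalLT_sigma _ _ ?_ (fun v ↦ ?_)
      · rw [hasCardinalLT_succ_iff]
        exact (hV z).trans (cantor θ).le
      · rw [hasCardinalLT_succ_iff]
        refine (mk_subtype_le _).trans ?_
        rw [mk_set]
        refine power_le_power_left two_ne_zero (le_trans ?_ (hV z))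
        refine mk_le_of_injective (f := fun u ↦ ⟨v.1, u.left⟩) ?_
        intro u u' h
        exact CostructuredArrow.hom_ext _ _ (eq_of_heq (Sigma.mk.inj_iff.1 h).2)
  have hm (a : A) (s : Set T) (hs : HasCardinalLT s κ) :
      HasCardinalLT { y : CostructuredArrow L (X.obj a) // ⟨a, y⟩ ∈ s } κ :=
    hs.of_injective (fun y ↦ (⟨⟨a, y.1⟩, y.2⟩ : s)) (fun y y' h ↦
      Subtype.ext (eq_of_heq (Sigma.mk.inj_iff.1 (Subtype.ext_iff.1 h)).2))
  let m (a : A) (s : Set T) (hs : HasCardinalLT s κ) : T :=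
    ⟨a, IsCardinalFiltered.max (fun y ↦ y.1) (hm a s hs)⟩
  have hA' : #A ≤ 2 ^ θ := by
    refine le_trans (le_trans (mk_le_of_injective (f := fun a : A ↦ Arrow.mk (𝟙 a)) ?_) hA)
      (cantor θ).le
    intro a b h
    exact congr_arg Comma.left h
  obtain ⟨S, hBS, hS, hNS, hmS⟩ := exists_closed_superset hθ hκθ hA' N hN m B
    (hasCardinalLT_succ_iff.1 hB)
  refine ⟨S, hBS, hasCardinalLT_succ_iff.2 hS, fun a ↦ ⟨fun y z u hz ↦ ?_, ?_⟩,
    fun a b f y hy ↦ hNS _ hy (.inl (.inr ⟨⟨b, f⟩, rfl⟩))⟩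
  · obtain ⟨v, rfl⟩ := CostructuredArrow.exists_eq_mk_of_hom u
    exact hNS _ hz (.inl (.inl ⟨v, rfl⟩))
  · let Q : ObjectProperty (CostructuredArrow L (X.obj a)) := fun y ↦ ⟨a, y⟩ ∈ S
    have h₁ ⦃ι : Type w⦄ (j : ι → Q.FullSubcategory) (hι : HasCardinalLT ι κ) :
        ∃ (k : Q.FullSubcategory), ∀ (i : ι), Nonempty (j i ⟶ k) := by
      let s : Set T := Set.range (fun i ↦ ⟨a, (j i).obj⟩)
      have hs : HasCardinalLT s κ := hι.of_surjective _ Set.rangeFactorization_surjective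
      refine ⟨⟨_, hmS a s hs ?_⟩, fun i ↦ ⟨ObjectProperty.homMk ?_⟩⟩
      · rintro _ ⟨i, rfl⟩
        exact (j i).property
      · exact IsCardinalFiltered.toMax
          (fun y : { y : CostructuredArrow L (X.obj a) // ⟨a, y⟩ ∈ s } ↦ y.1) (hm a s hs)
          ⟨(j i).obj, i, rfl⟩
    refine (isCardinalFiltered_iff Q.FullSubcategory κ).2 ⟨h₁, ?_⟩
    rintro ι ⟨j, hj⟩ ⟨k, hk⟩ f hι
    obtain hι' | ⟨⟨i₀⟩⟩ := isEmpty_or_nonempty ι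
    · obtain ⟨l, hl⟩ := h₁ (fun b : ULift.{w} Bool ↦ if b.down then ⟨j, hj⟩ else ⟨k, hk⟩)
        (hasCardinalLT_of_finite _ _ hκ)
      exact ⟨l, (hl ⟨false⟩).some, (hl ⟨true⟩).some, fun i ↦ hι'.elim i⟩
    · obtain ⟨v, rfl⟩ := CostructuredArrow.exists_eq_mk_of_hom (f i₀).hom
      let U : Set (y ⟨a, k⟩ v ⟶ k) := Set.range (fun i ↦ (f i).hom)
      have hU : HasCardinalLT U κ := hι.of_surjective _ Set.rangeFactorization_surjective
      refine ⟨⟨IsCardinalFiltered.coeq (fun u : U ↦ u.1) hU, hNS _ hk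
        (.inr ⟨⟨v, ⟨U, hU⟩⟩, rfl⟩)⟩, ObjectProperty.homMk (IsCardinalFiltered.coeqHom _ hU),
        ObjectProperty.homMk (IsCardinalFiltered.toCoeq _ hU), fun i ↦ ?_⟩
      ext1
      exact IsCardinalFiltered.coeq_condition (fun u : U ↦ u.1) hU ⟨_, i, rfl⟩

end

section

variable {P : Type w} [SmallCategory P] {E : Type u₁} [Category.{w} E]
  {L : P ⥤ E} (κ : Cardinal.{w}) [Fact κ.IsRegular]
  [∀ Y, IsCardinalFiltered (CostructuredArrow L Y) κ]
  {A : Type w} [SmallCategory A]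
  [L.Full] [L.IsDense] [HasCardinalFilteredColimits E κ]

/-- Any functor is a `(2 ^ θ)⁺`-filtered union of subfunctors whose values are colimits of
at most `2 ^ θ` objects which are `κ`-presentable. -/
lemma exists_colimitsOfShape_functor (hL : ∀ p, IsCardinalPresentable (L.obj p) κ)
    (X : A ⥤ E) {θ : Cardinal.{w}} (hκθ : κ ≤ θ)
    (hP : #(Arrow P) ≤ θ) (hA : #(Arrow A) ≤ θ) [Fact (Order.succ ((2 : Cardinal) ^ θ)).IsRegular] :
    ∃ (J : Type w) (_ : SmallCategory J) (_ : IsCardinalFiltered J (Order.succ (2 ^ θ))),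
      ObjectProperty.colimitsOfShape (fun G : A ⥤ E ↦ ∀ a,
        (isCardinalPresentable E κ).colimitsCardinalClosure (Order.succ (2 ^ θ)) (G.obj a))
        J X := by
  have hκμ : κ ≤ Order.succ (2 ^ θ) := hκθ.trans ((cantor θ).le.trans (Order.le_succ _))
  have hP' : HasCardinalLT (Arrow P) (Order.succ (2 ^ θ)) :=
    hasCardinalLT_succ_iff.2 (hP.trans (cantor θ).le)
  let T := Σ a, CostructuredArrow L (X.obj a)
  let J := { S : Set T // HasCardinalLT S (Order.succ (2 ^ θ)) ∧
    (∀ a, IsCardinalFilteredSieve κ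
        (fun y ↦ ⟨a, y⟩ ∈ S : ObjectProperty (CostructuredArrow L (X.obj a)))) ∧
      ∀ ⦃a b : A⦄ (f : a ⟶ b) (y : CostructuredArrow L (X.obj a)), ⟨a, y⟩ ∈ S →
        ⟨b, (CostructuredArrow.map (X.map f)).obj y⟩ ∈ S }
  have exists_ge (B : Set T) (hB : HasCardinalLT B (Order.succ (2 ^ θ))) :
      ∃ S : J, B ⊆ S.1 := by
    obtain ⟨S, hBS, hS⟩ := exists_isCardinalFilteredSieve κ X hκθ hP hA B hB
    exact ⟨⟨S, hS⟩, hBS⟩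
  have hJ : IsCardinalFiltered J (Order.succ (2 ^ θ)) :=
    isCardinalFiltered_preorder _ _ (fun K s hK ↦ by
      obtain ⟨S, hS⟩ := exists_ge (⋃ k, (s k).1) (hasCardinalLT_iUnion _
        ((hasCardinalLT_iff_cardinal_mk_lt _ _).2 hK) (fun k ↦ (s k).2.1))
      exact ⟨S, fun k ↦ (Set.subset_iUnion (fun k ↦ (s k).1) k).trans hS⟩)
  have hJκ : IsCardinalFiltered J κ := .of_le _ hκμ
  choose M m hm hSm hM using fun S : J ↦ exists_subfunctor κ hL X (fun a y ↦ ⟨a, y⟩ ∈ S.1)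
    S.2.2.1 S.2.2.2 hP' (fun a ↦ S.2.1.of_injective (fun y ↦ ⟨⟨a, y.1⟩, y.2⟩)
      (fun _ _ h ↦ Subtype.ext (eq_of_heq (Sigma.mk.inj_iff.1 (Subtype.ext_iff.1 h)).2)))
  have hm' (S : J) : Mono (m S) := NatTrans.mono_of_mono_app _
  have (S S' : J) (h : S ≤ S') : ∃ f : M S ⟶ M S', f ≫ m S' = m S := by
    have (a : A) : ∃ f : (M S).obj a ⟶ (M S').obj a, f ≫ (m S').app a = (m S).app a :=
      Functor.IsDense.exists_factorization L _ _ (fun p z ↦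
        (hSm S' a p _).1 (h ((hSm S a p _).2 ⟨z, rfl⟩)))
    choose f hf using this
    exact ⟨{ app := f, naturality a b g := by
               simp [← cancel_mono ((m S').app b), hf, reassoc_of% hf] }, by
      ext a
      exact hf a⟩
  choose f hf using this
  let D : J ⥤ A ⥤ E :=
    { obj := M
      map g := f _ _ (leOfHom g)
      map_id S := by simp [← cancel_mono (m S), hf]
      map_comp g g' := by simp [← cancel_mono (m _), hf] }
  let c : Cocone D :=
    { pt := X
      ι := { app := m, naturality S S' g := (hf _ _ _).trans (Category.comp_id _).symm } }
  have hc : IsColimit c := evaluationJointlyReflectsColimits _ (fun a ↦ by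
    have (S : J) : Mono ((((evaluation A E).obj a).mapCocone c).ι.app S) := hm S a
    refine (nonempty_isColimit_of_mono (L := L) κ hL _ (fun p x ↦ ?_)).some
    obtain ⟨S, hS⟩ := exists_ge {⟨a, CostructuredArrow.mk x⟩}
      (hasCardinalLT_of_finite _ _ (IsRegular.aleph0_le Fact.out))
    exact ⟨S, (hSm S a p x).1 (hS rfl)⟩)
  exact ⟨J, inferInstance, hJ, ⟨{ diag := D, ι := c.ι, isColimit := hc, prop_diag_obj := hM }⟩⟩

end

section

variable (A : Type w) [SmallCategory A]

lemma isAccessibleCategory_functor_of_homs_small (E : Type u₁) [Category.{w} E]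
    (κ : Cardinal.{w}) [Fact κ.IsRegular] [IsCardinalAccessibleCategory E κ] :
    IsAccessibleCategory.{w} (A ⥤ E) := by
  let e := equivSmallModel.{w} (isCardinalPresentable E κ).FullSubcategory
  let P := SmallModel.{w} (isCardinalPresentable E κ).FullSubcategory
  let L : P ⥤ E := e.inverse ⋙ (isCardinalPresentable E κ).ι
  have hL (p : P) : IsCardinalPresentable (L.obj p) κ := (e.inverse.obj p).property
  have (Y : E) : IsCardinalFiltered (CostructuredArrow L Y) κ :=
    IsCardinalFiltered.of_equivalence κ
      (CostructuredArrow.pre e.inverse (isCardinalPresentable E κ).ι Y).asEquivalence.symm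
  obtain ⟨θ, hκθ, hP, hA⟩ : ∃ θ : Cardinal.{w}, κ ≤ θ ∧ #(Arrow P) ≤ θ ∧ #(Arrow A) ≤ θ :=
    ⟨κ ⊔ #(Arrow P) ⊔ #(Arrow A), le_sup_left.trans le_sup_left, le_sup_right.trans le_sup_left,
      le_sup_right⟩
  have hθ : ℵ₀ ≤ θ := (IsRegular.aleph0_le Fact.out).trans hκθ
  have : Fact (Order.succ ((2 : Cardinal) ^ θ)).IsRegular :=
    ⟨isRegular_succ (hθ.trans (cantor θ).le)⟩
  have hκμ : κ ≤ Order.succ (2 ^ θ) := hκθ.trans ((cantor θ).le.trans (Order.le_succ _))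
  have : HasCardinalFilteredColimits E (Order.succ (2 ^ θ)) := ⟨fun J _ _ ↦
    have := IsCardinalFiltered.of_le J hκμ
    HasCardinalFilteredColimits.hasColimitsOfShape E κ J⟩
  let Q := (isCardinalPresentable E κ).colimitsCardinalClosure (Order.succ (2 ^ θ))
  have hQ : Q ≤ isCardinalPresentable E (Order.succ (2 ^ θ)) :=
    ObjectProperty.colimitsCardinalClosure_le_isCardinalPresentable _
      (isCardinalPresentable_monotone E hκμ)
  have gen : ObjectProperty.IsCardinalFilteredGenerator
      (fun G : A ⥤ E ↦ ∀ a, Q (G.obj a)) (Order.succ (2 ^ θ)) :=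
    { le_isCardinalPresentable G hG := isCardinalPresentable_functor _
        (hasCardinalLT_succ_iff.2 (hA.trans (cantor θ).le)) G (fun a ↦ hQ _ (hG a))
      exists_colimitsOfShape X := exists_colimitsOfShape_functor κ hL X hκθ hP hA }
  have := essentiallySmall_functor A Q
  have := gen.hasCardinalFilteredGenerator
  exact ⟨Order.succ (2 ^ θ), inferInstance, { toHasCardinalFilteredGenerator := this }⟩

/-- The category of functors from a small category to an accessible category is accessible. -/
instance isAccessibleCategory_functor (E : Type u₁) [Category.{v₁} E]
    [IsAccessibleCategory.{w} E] : IsAccessibleCategory.{w} (A ⥤ E) := by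
  obtain ⟨κ, _, _⟩ := IsAccessibleCategory.exists_cardinal.{w} E
  let e := ShrinkHoms.equivalence.{w} E
  have := e.isCardinalAccessibleCategory κ
  have := isAccessibleCategory_functor_of_homs_small A (ShrinkHoms.{u₁} E) κ
  exact e.symm.congrRight.isAccessibleCategory

end

end CategoryTheory

theorem mainTheorem4 (κ : Cardinal.{w}) [Fact κ.IsRegular]
    (C : Type u₁) [Category.{v₁} C] (E : Type u₂) [Category.{v₂} E]
    [IsCardinalAccessibleCategory C κ] [IsCardinalAccessibleCategory E κ] :
    IsAccessibleCategory.{w} (CardinalAccessibleFunctor C E κ) ∧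
      (restrictToCompactObjects C E κ).IsEquivalence := by
  have h := isEquivalence_restrictToCompactObjects C E κ
  have : IsAccessibleCategory.{w} E := ⟨κ, inferInstance, inferInstance⟩
  let e := equivSmallModel.{w} (CompactObjects C κ)
  exact ⟨(e.congrLeft.symm.trans
    (restrictToCompactObjects C E κ).asEquivalence.symm).isAccessibleCategory, h⟩
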